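/- A chord diagram with $V$ chords is a perfect matching of $2V$ points in a row; its intersection graph $G$ has the $V$ chords as vertices, two of them being joined by an edge iff the chords cross. Let $E$ be the number of edges and $T$ the number of triangles of $G$. For integers $q\ge 0$ and $N\ge q$ put $$\eta_G=(-1)^{Eq}\binom Nq^{-V}\sum_{\alpha_1,\dots,\alpha_V}(-1)^{c(G)},\qquad c(G)=\sum_{\{i,j\}\text{ edge of }G}|\alpha_i\cap\alpha_j|,$$ where each $\alpha_i$ runs over all $q$-element subsets of $\{1,\dots,N\}$, and $$\eta=\binom Nq^{-1}\sum_{k=0}^q(-1)^{q+k}\binom{N-q}{q-k}\binom qk .$$ Fix $q$ and $V$. Then, as $N\to\infty$, for every intersection graph $G$ of a chord diagram with $V$ chords, $$\eta_G-\eta^E=-\frac{8q^3}{N^2}(-1)^{qE}\,T+O\!\left(\frac1{N^3}\right),$$ and in particular $\eta_G-\eta^E=O(1/N^2)$. Consequently, for real numbers $a_1,a_2$, the sums over the intersection graphs of all $(2V-1)!!$ chord diagrams with $V$ chords satisfy $$\sum_{G}\eta_{G}-\sum_{G}\eta^{E(G)}=\frac{a_1}{N}+\frac{a_2}{N^2}+O\!\left(\frac1{N^3}\right)$$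 if and only if $a_1=0$ and $a_2=-8q^3\sum_{G}(-1)^{qE(G)}T(G)$: there is no $1/N$ correction, and the whole $1/N^2$ correction comes from triangles. -/

import Mathlib

open Filter Asymptotics
open scoped BigOperators

/-- A chord diagram with `p` chords (equivalently, a Wick contraction of `2 p` points in a row):
a fixed-point-free involution of the `2 p` points, sending every point to the other endpoint of
its chord. -/
abbrev ChordDiagram (p : ℕ) : Type :=
  {σ : Equiv.Perm (Fin (2 * p)) // ∀ i, σ (σ i) = i ∧ σ i ≠ i}

namespace ChordDiagram

/-- The chords of a diagram, each one represented by its left endpoint. -/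
abbrev Chord {p : ℕ} (D : ChordDiagram p) : Type :=
  {i : Fin (2 * p) // i < D.1 i}

/-- The chord with endpoints `a < a'` meets the chord with endpoints `b < b'` in the pattern
`a < b < a' < b'`. -/
abbrev CrossesRight {p : ℕ} (D : ChordDiagram p) (a b : D.Chord) : Prop :=
  a.1 < b.1 ∧ b.1 < D.1 a.1 ∧ D.1 a.1 < D.1 b.1

/-- The intersection graph: vertices are the chords, edges join two chords that cross. -/
def intersectionGraph {p : ℕ} (D : ChordDiagram p) : SimpleGraph D.Chord where
  Adj a b := D.CrossesRight a b ∨ D.CrossesRight b a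
  symm := ⟨fun _ _ h => h.symm⟩
  loopless := ⟨fun _ h => h.elim (fun h' => lt_irrefl _ h'.1) (fun h' => lt_irrefl _ h'.1)⟩

instance {p : ℕ} (D : ChordDiagram p) : DecidableRel D.intersectionGraph.Adj :=
  fun a b => inferInstanceAs (Decidable (D.CrossesRight a b ∨ D.CrossesRight b a))

end ChordDiagram

/-- The possible index sets: the subsets with `q` elements of an `N`-element set. -/
abbrev IndexSet (N q : ℕ) : Type := {s : Finset (Fin N) // s.card = q}

section Graph

variable {W : Type} [Fintype W] [DecidableEq W] (G : SimpleGraph W) [DecidableRel G.Adj]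

/-- The number of edges `E` of a graph. -/
def numEdges : ℕ := G.edgeFinset.card

/-- The number of triangles `T` of a graph. -/
def numTriangles : ℕ := (G.cliqueFinset 3).card

/-- The exponent `c(G)`: the sum of `|α i ∩ α j|` over all edges `{i, j}` of `G`. -/
def overlap {N q : ℕ} (α : W → IndexSet N q) : ℕ :=
  ∑ e ∈ G.edgeFinset,
    Sym2.lift ⟨fun i j => ((α i).1 ∩ (α j).1).card,
      fun i j => congrArg Finset.card (Finset.inter_comm (α i).1 (α j).1)⟩ e

/-- `η_G = (-1)^(E q) * (N choose q)^(-V) * ∑_{α_1, …, α_V} (-1)^(c(G))`. -/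
noncomputable def etaG (q N : ℕ) : ℝ :=
  (-1) ^ (numEdges G * q) * ((N.choose q : ℝ) ^ Fintype.card W)⁻¹ *
    ∑ α : W → IndexSet N q, (-1) ^ overlap G α

end Graph

/-- `η = (N choose q)^(-1) * ∑_{k=0}^q (-1)^(q+k) * (N-q choose q-k) * (q choose k)`. -/
noncomputable def eta (q N : ℕ) : ℝ :=
  (N.choose q : ℝ)⁻¹ *
    ∑ k ∈ Finset.range (q + 1),
      (-1) ^ (q + k) * ((N - q).choose (q - k) : ℝ) * (q.choose k : ℝ)

/-!
Write `k` for the size `|α_i ∩ α_j|` carried by an edge, `h = 1 - (-1)^k` for its parity defect and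
`m` for the mean of `h`. Given `α_i`, the size `k` is hypergeometric whatever `α_i` is, so that
`η = (-1)^q (1 - m)`. The defect satisfies `0 ≤ h ≤ 2 k`, hence `m = O(1 / N)`.

Each factor `(-1)^k` of `η_G` is `(1 - m) + (m - h)`. Expanding the product over the edges gives
`(-1)^{qE} η_G = ∑_S (1 - m)^{E - |S|} 𝔼 ∏_{e ∈ S} (m - h_e)`, the sum being over all sets `S` of
edges. The set `S = ∅` contributes `(1 - m)^E = ((-1)^q η)^E`. The other sets are treated
as follows.

* An edge with an end that lies on no other edge of `S` splits off its mean
  (`expect_mul_meet_of_leaf`): resample the index set at this end. Three edges or fewer always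
  include such an edge unless they form a triangle (`exists_leaf`), so that then the mean of the
  product is the product of the means (`expect_prod_meet`), which is `0` for the centred `m - h`.
* Four edges or more include three that do not form a triangle (`exists_subset_not_isTriangle`).
  The other factors being bounded, the mean is at most a constant times `(𝔼 |m - h|)^3`, which is
  `O(1 / N^3)`.
* For a triangle, factorization along paths reduces the mean to `m^3 - 𝔼 h h' h''`. Replacing each
  `h` by `2 k` costs `O(1 / N^3)`, because `2 k - h ≤ 2 (k^2 - k)`, one of the other factors is at
  most `2 q`, and the remaining two are uncorrelated. The mean of `k k' k''` is found by resampling one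
  vertex (`expect_triangle_natCast`); it is `q^3 / N^2 + O(1 / N^3)`. So each triangle contributes
  `-8 q^3 / N^2 + O(1 / N^3)` (`expect_triangle_bound`).

Nothing here uses that `G` comes from a chord diagram: the expansion holds for every graph
(`etaG_sub_eta_pow_isBigO`). The coefficients in the sum over all diagrams are then determined by
the uniqueness of asymptotic expansions (`isBigO_inv_cube_iff`).
-/

/-! ### Random index sets and the hypergeometric mean -/

section IndexSetMoments

open Finset

/-- The number of `q`-subsets that meet a given set `A` in exactly `k` points. -/
lemma card_filter_card_inter_eq {α : Type*} [Fintype α] [DecidableEq α] (A : Finset α) {q k : ℕ}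
    (hk : k ≤ q) :
    #{B ∈ powersetCard q (univ : Finset α) | #(A ∩ B) = k} =
      (#A).choose k * (Fintype.card α - #A).choose (q - k) := by
  rw [← card_compl, ← card_powersetCard k A, ← card_powersetCard (q - k) Aᶜ, ← card_product]
  refine card_nbij' (fun B => (A ∩ B, Aᶜ ∩ B)) (fun P => P.1 ∪ P.2) ?_ ?_ ?_ ?_
  · intro B hB
    simp only [coe_filter, mem_powersetCard, subset_univ, true_and, Set.mem_ofPred_eq] at hB
    have h : #(A ∩ B) + #(Aᶜ ∩ B) = #B := by
      rw [inter_comm A, inter_comm Aᶜ, ← sdiff_eq_inter_compl, card_inter_add_card_sdiff]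
    simp only [coe_product, Set.mem_prod, mem_coe, mem_powersetCard, inter_subset_left, true_and]
    omega
  · rintro ⟨P, Q⟩ hPQ
    simp only [coe_product, Set.mem_prod, mem_coe, mem_powersetCard] at hPQ
    obtain ⟨⟨hP, hPk⟩, hQ, hQk⟩ := hPQ
    have hd : Disjoint P Q := disjoint_of_subset_left hP (subset_compl_iff_disjoint_left.1 hQ)
    have hA : A ∩ (P ∪ Q) = P := by
      rw [inter_union_distrib_left, inter_eq_right.2 hP,
        disjoint_iff_inter_eq_empty.1 (subset_compl_iff_disjoint_left.1 hQ), union_empty]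
    simp only [coe_filter, mem_powersetCard, subset_univ, true_and, Set.mem_ofPred_eq, hA, hPk,
      card_union_of_disjoint hd, hQk]
    exact ⟨by omega, trivial⟩
  · intro B _
    ext x
    by_cases hx : x ∈ A <;> simp [hx]
  · rintro ⟨P, Q⟩ hPQ
    simp only [coe_product, Set.mem_prod, mem_coe, mem_powersetCard] at hPQ
    obtain ⟨⟨hP, -⟩, hQ, -⟩ := hPQ
    ext x
    · have := @hP x
      have := @hQ x
      simp at *
      tauto
    · have := @hP x
      have := @hQ x
      simp at *
      tauto

lemma card_indexSet (N q : ℕ) : Fintype.card (IndexSet N q) = N.choose q := by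
  simp

lemma indexSet_nonempty {N q : ℕ} (h : q ≤ N) : Nonempty (IndexSet N q) := by
  rw [← Fintype.card_pos_iff, card_indexSet]
  exact Nat.choose_pos h

/-- The mean of `φ k` when `k` is hypergeometric: `k` is the size of the intersection of a fixed
and a uniformly random `q`-subset of an `N`-element set. -/
noncomputable def hyperMean (q N : ℕ) (φ : ℕ → ℝ) : ℝ :=
  (N.choose q : ℝ)⁻¹ *
    ∑ k ∈ range (q + 1), (q.choose k : ℝ) * ((N - q).choose (q - k) : ℝ) * φ k

lemma expect_card_inter {N q : ℕ} (A : Finset (Fin N)) (φ : ℕ → ℝ) :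
    𝔼 β : IndexSet N q, φ #(A ∩ β.1) = (N.choose q : ℝ)⁻¹ *
      ∑ k ∈ range (q + 1), ((#A).choose k : ℝ) * ((N - #A).choose (q - k) : ℝ) * φ k := by
  rw [Fintype.expect_eq_sum_div_card, card_indexSet, div_eq_inv_mul]
  congr 1
  have h : ∑ β : IndexSet N q, φ #(A ∩ β.1) =
      ∑ B ∈ powersetCard q (univ : Finset (Fin N)), φ #(A ∩ B) :=
    (sum_subtype _ (by simp) (fun B : Finset (Fin N) => φ #(A ∩ B))).symm
  rw [h, ← sum_fiberwise_of_maps_to (g := fun B => #(A ∩ B)) (t := range (q + 1))]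
  · refine sum_congr rfl fun k hk => ?_
    have hk' : k ≤ q := Nat.lt_succ_iff.1 (mem_range.1 hk)
    rw [sum_congr rfl (g := fun _ => φ k) (fun B hB => by rw [(mem_filter.1 hB).2]), sum_const,
      card_filter_card_inter_eq A hk', Fintype.card_fin, nsmul_eq_mul]
    push_cast
    ring
  · intro B hB
    rw [mem_range, Nat.lt_succ_iff, ← (mem_powersetCard.1 hB).2]
    exact card_le_card inter_subset_right

lemma expect_card_inter_indexSet {N q : ℕ} (A : IndexSet N q) (φ : ℕ → ℝ) :
    𝔼 β : IndexSet N q, φ #(A.1 ∩ β.1) = hyperMean q N φ := by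
  rw [expect_card_inter, A.2, hyperMean]

/-- The probability that a random `q`-subset contains a given point. -/
lemma expect_mem {N q : ℕ} (h : q ≤ N) (a : Fin N) :
    𝔼 β : IndexSet N q, (if a ∈ β.1 then (1 : ℝ) else 0) = q / N := by
  -- apply the hypergeometric count to `{a}`
  have key := expect_card_inter (q := q) {a} (fun k => if k = 1 then (1 : ℝ) else 0)
  have e : ∀ β : IndexSet N q, (if #({a} ∩ β.1) = 1 then (1 : ℝ) else 0) =
      if a ∈ β.1 then 1 else 0 := by
    intro β
    by_cases ha : a ∈ β.1 <;> simp [ha, singleton_inter_of_mem, singleton_inter_of_notMem]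
  simp only [e] at key
  rw [key]
  rcases q with _ | q
  · simp
  obtain ⟨n, rfl⟩ : ∃ n, N = n + 1 := ⟨N - 1, by omega⟩
  have hc := Nat.add_one_mul_choose_eq n q
  have hpos : (0 : ℝ) < ((n + 1).choose (q + 1) : ℕ) := by
    exact_mod_cast Nat.choose_pos h
  have hc' : ((n : ℝ) + 1) * (n.choose q : ℝ) = ((n + 1).choose (q + 1) : ℕ) * ((q : ℝ) + 1) := by
    exact_mod_cast hc
  simp only [card_singleton, mul_ite, mul_one, mul_zero, sum_ite_eq', mem_range]
  rw [if_pos (by omega)]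
  have hn : ((n : ℝ) + 1) ≠ 0 := by positivity
  simp only [Nat.choose_self, Nat.cast_one, one_mul, Nat.add_sub_cancel]
  push_cast
  field_simp
  linarith

/-- The probability that a random `q`-subset contains two given points. -/
lemma expect_mem_mem {N q : ℕ} (h : q ≤ N) {a b : Fin N} (hab : a ≠ b) :
    𝔼 β : IndexSet N q, (if a ∈ β.1 then (1 : ℝ) else 0) * (if b ∈ β.1 then (1 : ℝ) else 0) =
      q * (q - 1) / (N * (N - 1)) := by
  have key := expect_card_inter (q := q) {a, b} (fun k => if k = 2 then (1 : ℝ) else 0)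
  have e : ∀ β : IndexSet N q, (if #({a, b} ∩ β.1) = 2 then (1 : ℝ) else 0) =
      (if a ∈ β.1 then 1 else 0) * (if b ∈ β.1 then 1 else 0) := by
    intro β
    by_cases ha : a ∈ β.1 <;> by_cases hb : b ∈ β.1 <;>
      simp [ha, hb, hab, insert_inter_of_mem, insert_inter_of_notMem, singleton_inter_of_mem,
        singleton_inter_of_notMem]
  simp only [e] at key
  rw [key]
  have hN : 2 ≤ N := by
    have := Fintype.one_lt_card_iff.2 ⟨a, b, hab⟩
    rwa [Fintype.card_fin] at this
  rcases q with _ | _ | q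
  · simp
  · simp
  obtain ⟨n, rfl⟩ : ∃ n, N = n + 2 := ⟨N - 2, by omega⟩
  have hc1 := Nat.add_one_mul_choose_eq n q
  have hc2 := Nat.add_one_mul_choose_eq (n + 1) (q + 1)
  have hpos : (0 : ℝ) < ((n + 2).choose (q + 2) : ℕ) := by
    exact_mod_cast Nat.choose_pos h
  have hc1' : ((n : ℝ) + 1) * (n.choose q : ℝ) = ((n + 1).choose (q + 1) : ℕ) * ((q : ℝ) + 1) := by
    exact_mod_cast hc1
  have hc2' : ((n : ℝ) + 2) * ((n + 1).choose (q + 1) : ℝ) =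
      ((n + 2).choose (q + 2) : ℕ) * ((q : ℝ) + 2) := by
    exact_mod_cast hc2
  rw [card_pair hab]
  simp only [mul_ite, mul_one, mul_zero, sum_ite_eq', mem_range]
  rw [if_pos (by omega)]
  have hn : ((n : ℝ) + 1) ≠ 0 := by positivity
  have hn2 : ((n : ℝ) + 2) ≠ 0 := by positivity
  have s1 : ((n + 2 : ℕ) : ℝ) - 1 = n + 1 := by push_cast; ring
  have s2 : ((q + 1 + 1 : ℕ) : ℝ) - 1 = q + 1 := by push_cast; ring
  rw [s1, s2]
  simp only [Nat.choose_self, Nat.cast_one, one_mul, Nat.add_sub_cancel]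
  have s3 : q + 1 + 1 - 2 = q := by omega
  rw [s3, inv_mul_eq_div, div_eq_div_iff hpos.ne' (by push_cast; positivity)]
  push_cast
  linear_combination ((n : ℝ) + 2) * hc1' + ((q : ℝ) + 1) * hc2'

/-- The mean of `|A ∩ β| |B ∩ β|` over a random `q`-subset `β`: the sum over `a ∈ A`, `b ∈ B` of
the probability that `β` contains both. -/
lemma expect_card_inter_mul_card_inter {N q : ℕ} (h : q ≤ N) (A B : Finset (Fin N)) :
    𝔼 β : IndexSet N q, (#(A ∩ β.1) : ℝ) * (#(B ∩ β.1) : ℝ) =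
      #(A ∩ B) * ((q : ℝ) / N - q * (q - 1) / (N * (N - 1))) +
        #A * #B * (q * (q - 1) / (N * (N - 1))) := by
  have e : ∀ (A : Finset (Fin N)) (β : IndexSet N q),
      (#(A ∩ β.1) : ℝ) = ∑ a ∈ A, if a ∈ β.1 then (1 : ℝ) else 0 := by
    intro A β
    simp
  simp only [e, sum_mul_sum]
  rw [expect_sum_comm]
  simp only [expect_sum_comm]
  have t : ∀ a b : Fin N, 𝔼 β : IndexSet N q,
      (if a ∈ β.1 then (1 : ℝ) else 0) * (if b ∈ β.1 then (1 : ℝ) else 0) =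
      (if a = b then ((q : ℝ) / N - q * (q - 1) / (N * (N - 1))) else 0) +
        q * (q - 1) / (N * (N - 1)) := by
    intro a b
    by_cases hab : a = b
    · subst hab
      simp only [if_true, sub_add_cancel, ← expect_mem h a]
      exact expect_congr rfl fun β _ => by split_ifs <;> simp
    · rw [expect_mem_mem h hab, if_neg hab, zero_add]
  simp only [t, sum_add_distrib, sum_ite_eq, sum_const, ← sum_filter, nsmul_eq_mul,
    filter_mem_eq_inter]
  ring

lemma hyperMean_natCast {N q : ℕ} (h : q ≤ N) :
    hyperMean q N (fun k => (k : ℝ)) = q ^ 2 / N := by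
  obtain ⟨A⟩ := indexSet_nonempty h
  rw [← expect_card_inter_indexSet A]
  have e : ∀ β : IndexSet N q, (#(A.1 ∩ β.1) : ℝ) = ∑ a ∈ A.1, if a ∈ β.1 then (1 : ℝ) else 0 := by
    intro β
    simp
  simp only [e]
  rw [expect_sum_comm]
  simp only [expect_mem h, sum_const, A.2, nsmul_eq_mul]
  ring

lemma hyperMean_sq {N q : ℕ} (h : q ≤ N) :
    hyperMean q N (fun k => (k : ℝ) ^ 2) =
      q ^ 2 / N + q * (q - 1) * (q * (q - 1) / (N * (N - 1))) := by
  obtain ⟨A⟩ := indexSet_nonempty h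
  rw [← expect_card_inter_indexSet A]
  simp only [sq (Nat.cast _ : ℝ)]
  rw [expect_card_inter_mul_card_inter h, inter_self, A.2]
  ring

lemma hyperMean_const {N q : ℕ} (h : q ≤ N) (c : ℝ) : hyperMean q N (fun _ => c) = c := by
  have hne := indexSet_nonempty h
  rw [← expect_card_inter_indexSet hne.some, Fintype.expect_const]

lemma hyperMean_sub (q N : ℕ) (φ ψ : ℕ → ℝ) :
    hyperMean q N (fun k => φ k - ψ k) = hyperMean q N φ - hyperMean q N ψ := by
  simp only [hyperMean, mul_sub, sum_sub_distrib]

lemma hyperMean_add (q N : ℕ) (φ ψ : ℕ → ℝ) :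
    hyperMean q N (fun k => φ k + ψ k) = hyperMean q N φ + hyperMean q N ψ := by
  simp only [hyperMean, mul_add, sum_add_distrib]

lemma hyperMean_const_mul (q N : ℕ) (c : ℝ) (φ : ℕ → ℝ) :
    hyperMean q N (fun k => c * φ k) = c * hyperMean q N φ := by
  simp only [hyperMean, mul_sum]
  exact sum_congr rfl fun k _ => by ring

lemma hyperMean_mono (q N : ℕ) {φ ψ : ℕ → ℝ} (h : ∀ k, φ k ≤ ψ k) :
    hyperMean q N φ ≤ hyperMean q N ψ := by
  unfold hyperMean
  gcongr with k _
  exact h k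

/-- The probability that a random `q`-subset contains two given points is at most `(q / N)²`. -/
lemma pair_prob_bounds {N q : ℕ} (h : q ≤ N) :
    0 ≤ (q : ℝ) * (q - 1) / (N * (N - 1)) ∧
      (q : ℝ) * (q - 1) / (N * (N - 1)) ≤ q ^ 2 / N ^ 2 := by
  rcases q with _ | q
  · simp
  obtain ⟨n, rfl⟩ : ∃ n, N = n + 1 := ⟨N - 1, by omega⟩
  have hqn : (q : ℝ) ≤ n := by exact_mod_cast Nat.le_of_succ_le_succ h
  push_cast
  simp only [add_sub_cancel_right]
  constructor
  · positivity
  -- for `N = 1` the quotient has the value `0`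
  rcases n with _ | n
  · simp; positivity
  rw [div_le_div_iff₀ (by positivity) (by positivity)]
  push_cast at *
  have hq0 : (0 : ℝ) ≤ q := q.cast_nonneg
  have h1 : (q : ℝ) * (n + 1 + 1) ≤ (q + 1) * (n + 1) := by linarith
  calc ((q : ℝ) + 1) * q * ((n + 1 + 1) ^ 2) = (q + 1) * (n + 1 + 1) * (q * (n + 1 + 1)) := by ring
    _ ≤ (q + 1) * (n + 1 + 1) * ((q + 1) * (n + 1)) := by gcongr
    _ = _ := by ring

end IndexSetMoments

/-! ### Resampling the index set of a vertex -/

section Resampling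

open Finset Function

/-- Averaging over families is unchanged when one coordinate is resampled independently. -/
lemma expect_update {W ι : Type*} [Fintype W] [DecidableEq W] [Fintype ι] [Nonempty ι] (v : W)
    (F : (W → ι) → ℝ) : 𝔼 α : W → ι, 𝔼 β : ι, F (update α v β) = 𝔼 α : W → ι, F α := by
  have h : 𝔼 P : (W → ι) × ι, F (update P.1 v P.2) = 𝔼 P : (W → ι) × ι, F P.1 := by
    have hinv : Involutive fun P : (W → ι) × ι => (update P.1 v P.2, P.1 v) := by
      rintro ⟨α, β⟩
      simp
    exact Fintype.expect_equiv hinv.toPerm _ _ fun P => rfl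
  rw [← univ_product_univ, expect_product, expect_product] at h
  simpa using h

/-- The number of common elements of the index sets at the two ends of an edge, the summand of
`overlap`. -/
def meet {W : Type} {N q : ℕ} (α : W → IndexSet N q) (e : Sym2 W) : ℕ :=
  Sym2.lift ⟨fun i j => ((α i).1 ∩ (α j).1).card,
    fun i j => congrArg Finset.card (Finset.inter_comm (α i).1 (α j).1)⟩ e

@[simp] lemma meet_mk {W : Type} {N q : ℕ} (α : W → IndexSet N q) (i j : W) :
    meet α s(i, j) = #((α i).1 ∩ (α j).1) := rfl

lemma meet_le {W : Type} {N q : ℕ} (α : W → IndexSet N q) (e : Sym2 W) : meet α e ≤ q := by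
  induction e with
  | _ i j => exact (card_le_card inter_subset_left).trans (α i).2.le

lemma meet_update_of_notMem {W : Type} [DecidableEq W] {N q : ℕ} (α : W → IndexSet N q) {v : W}
    (β : IndexSet N q) {e : Sym2 W} (hv : v ∉ e) : meet (update α v β) e = meet α e := by
  induction e with
  | _ i j =>
    rw [Sym2.mem_iff, not_or] at hv
    rw [meet_mk, meet_mk, update_of_ne (Ne.symm hv.1), update_of_ne (Ne.symm hv.2)]

/-- A factor carried by an edge `e` splits off the mean if the rest does not involve one end `v` of
`e`: given the other end, resampling `v` gives the hypergeometric mean, whatever the other index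
set is. -/
lemma expect_mul_meet_of_leaf {W : Type} [Fintype W] [DecidableEq W] {N q : ℕ} (h : q ≤ N)
    {e : Sym2 W} (he : ¬ e.IsDiag) {v : W} (hv : v ∈ e) (F : (W → IndexSet N q) → ℝ)
    (hF : ∀ α β, F (update α v β) = F α) (φ : ℕ → ℝ) :
    𝔼 α, F α * φ (meet α e) = hyperMean q N φ * 𝔼 α, F α := by
  have := indexSet_nonempty h
  obtain ⟨w, rfl⟩ := Sym2.mem_iff_exists.1 hv
  rw [← expect_update v, mul_expect]
  refine expect_congr rfl fun α _ => ?_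
  have hw : w ≠ v := fun hwv => he (by rw [hwv]; rfl)
  simp only [hF, meet_mk, update_self, update_of_ne hw]
  rw [← mul_expect, mul_comm (hyperMean q N φ), ← expect_card_inter_indexSet (α w) φ]
  simp only [inter_comm]

end Resampling

/-! ### Sets of edges with and without triangles -/

section Triangles

open Finset

/-- The set of edges of the complete graph on a vertex set `t`. -/
def edgesIn {W : Type} [DecidableEq W] (t : Finset W) : Finset (Sym2 W) :=
  t.sym2.filter fun e => ¬ e.IsDiag

/-- A set of edges that forms a triangle. -/
def IsTriangle {W : Type} [DecidableEq W] (S : Finset (Sym2 W)) : Prop :=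
  ∃ t : Finset W, #t = 3 ∧ S = edgesIn t

lemma mk_mem_edgesIn {W : Type} [DecidableEq W] {t : Finset W} {a b : W} :
    s(a, b) ∈ edgesIn t ↔ a ∈ t ∧ b ∈ t ∧ a ≠ b := by
  simp [edgesIn, and_assoc]

lemma edgesIn_triple {W : Type} [DecidableEq W] {a b c : W} (hab : a ≠ b) (hac : a ≠ c)
    (hbc : b ≠ c) : edgesIn {a, b, c} = {s(a, b), s(b, c), s(a, c)} := by
  ext e
  induction e with
  | _ x y =>
    rw [mk_mem_edgesIn]
    simp only [mem_insert, mem_singleton, Sym2.eq_iff]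
    grind

lemma isTriangle_iff {W : Type} [DecidableEq W] {S : Finset (Sym2 W)} :
    IsTriangle S ↔ ∃ a b c : W, a ≠ b ∧ a ≠ c ∧ b ≠ c ∧ S = {s(a, b), s(b, c), s(a, c)} := by
  constructor
  · rintro ⟨t, ht, rfl⟩
    obtain ⟨a, b, c, hab, hac, hbc, rfl⟩ := card_eq_three.1 ht
    exact ⟨a, b, c, hab, hac, hbc, edgesIn_triple hab hac hbc⟩
  · rintro ⟨a, b, c, hab, hac, hbc, rfl⟩
    exact ⟨{a, b, c}, card_eq_three.2 ⟨a, b, c, hab, hac, hbc, rfl⟩,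
      (edgesIn_triple hab hac hbc).symm⟩

lemma edgesIn_injOn {W : Type} [DecidableEq W] :
    Set.InjOn (edgesIn : Finset W → Finset (Sym2 W)) {t | #t = 3} := by
  -- `t` is recovered from its edges as the set of their ends
  have key : ∀ t : Finset W, #t = 3 → ∀ v, v ∈ t ↔ ∃ e ∈ edgesIn t, v ∈ e := by
    intro t ht v
    constructor
    · intro hv
      obtain ⟨w, hw, hwv⟩ := exists_mem_ne (by omega : 1 < #t) v
      exact ⟨s(v, w), mk_mem_edgesIn.2 ⟨hv, hw, hwv.symm⟩, Sym2.mem_mk_left v w⟩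
    · rintro ⟨e, he, hve⟩
      exact mem_sym2_iff.1 (mem_filter.1 he).1 v hve
  intro t ht t' ht' h
  ext v
  rw [key t ht, key t' ht', h]

/-- The triangles among the edge sets of a graph are counted by its cliques of size three. -/
lemma card_filter_isTriangle {W : Type} [Fintype W] [DecidableEq W] (G : SimpleGraph W)
    [DecidableRel G.Adj] [DecidablePred (IsTriangle (W := W))] :
    #(G.edgeFinset.powerset.filter IsTriangle) = numTriangles G := by
  have h : G.edgeFinset.powerset.filter IsTriangle = (G.cliqueFinset 3).image edgesIn := by
    ext S
    simp only [mem_filter, mem_powerset, mem_image, SimpleGraph.mem_cliqueFinset_iff,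
      SimpleGraph.isNClique_iff]
    have hcl : ∀ t : Finset W, edgesIn t ⊆ G.edgeFinset ↔ G.IsClique t := by
      intro t
      constructor
      · intro hs a ha b hb hab
        simpa using hs (mk_mem_edgesIn.2 ⟨ha, hb, hab⟩)
      · intro hs e he
        induction e with
        | _ a b =>
          obtain ⟨ha, hb, hab⟩ := mk_mem_edgesIn.1 he
          simpa using hs ha hb hab
    constructor
    · rintro ⟨hS, t, ht, rfl⟩
      exact ⟨t, ⟨(hcl t).1 hS, ht⟩, rfl⟩
    · rintro ⟨t, ⟨hs, ht⟩, rfl⟩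
      exact ⟨(hcl t).2 hs, t, ht, rfl⟩
  rw [h, card_image_of_injOn, numTriangles]
  intro t ht t' ht'
  simp only [mem_coe, SimpleGraph.mem_cliqueFinset_iff] at ht ht'
  exact edgesIn_injOn ht.card_eq ht'.card_eq

/-- At most three edges that do not form a triangle include an edge with a free end. -/
lemma exists_leaf {W : Type} [DecidableEq W] {S : Finset (Sym2 W)} (hd : ∀ e ∈ S, ¬ e.IsDiag)
    (hne : S.Nonempty) (hcard : #S ≤ 3) (ht : ¬ IsTriangle S) :
    ∃ e ∈ S, ∃ v ∈ e, ∀ e' ∈ S, e' ≠ e → v ∉ e' := by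
  by_contra! hcon
  -- follow the edges from both ends of an edge `ab`: they must be `ac` and `bc`
  obtain ⟨e, he⟩ := hne
  induction e with
  | _ a b =>
  have hab : a ≠ b := hd _ he
  obtain ⟨e', he', hne', ha⟩ := hcon _ he a (Sym2.mem_mk_left a b)
  obtain ⟨c, rfl⟩ := Sym2.mem_iff_exists.1 ha
  have hac : a ≠ c := hd _ he'
  have hbc : b ≠ c := fun h => hne' (by rw [h])
  obtain ⟨e'', he'', hne'', hb⟩ := hcon _ he b (Sym2.mem_mk_right a b)
  have hne3 : s(a, c) ≠ e'' := by
    rintro rfl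
    rcases Sym2.mem_iff.1 hb with h | h
    exacts [hab h.symm, hbc h]
  have hS : {s(a, b), s(a, c), e''} = S := by
    refine eq_of_subset_of_card_le (by simp [insert_subset_iff, he, he', he'']) ?_
    rwa [card_eq_three.2 ⟨_, _, _, hne'.symm, hne''.symm, hne3, rfl⟩]
  obtain ⟨e3, he3, hne4, hc⟩ := hcon _ he' c (Sym2.mem_mk_right a c)
  rw [← hS, mem_insert, mem_insert, mem_singleton] at he3
  rcases he3 with rfl | rfl | rfl
  · rcases Sym2.mem_iff.1 hc with h | h
    exacts [hac h.symm, hbc h.symm]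
  · exact hne4 rfl
  · have hbc' : e3 = s(b, c) := (Sym2.mem_and_mem_iff hbc).1 ⟨hb, hc⟩
    refine ht (isTriangle_iff.2 ⟨a, b, c, hab, hac, hbc, ?_⟩)
    rw [← hS, hbc', pair_comm]

/-- Two of the edges of a triangle determine the third, so four edges include three that do not
form a triangle. -/
lemma exists_subset_not_isTriangle {W : Type} [DecidableEq W] {S : Finset (Sym2 W)}
    (hcard : 4 ≤ #S) : ∃ F ⊆ S, #F = 3 ∧ ¬ IsTriangle F := by
  obtain ⟨F, hF, hF3⟩ := exists_subset_card_eq (by omega : 3 ≤ #S)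
  by_cases ht : IsTriangle F
  swap
  · exact ⟨F, hF, hF3, ht⟩
  obtain ⟨a, b, c, hab, hac, hbc, rfl⟩ := isTriangle_iff.1 ht
  obtain ⟨d, hdS, hdF⟩ := exists_mem_notMem_of_card_lt_card
    (by omega : #{s(a, b), s(b, c), s(a, c)} < #S)
  simp only [mem_insert, mem_singleton, not_or] at hdF
  simp only [insert_subset_iff, singleton_subset_iff] at hF
  have h1 : s(a, b) ≠ s(b, c) := by simp; grind
  have h3 : #{s(a, b), s(b, c), d} = 3 :=
    card_eq_three.2 ⟨_, _, _, h1, Ne.symm hdF.1, Ne.symm hdF.2.1, rfl⟩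
  refine ⟨{s(a, b), s(b, c), d}, by simp [insert_subset_iff, hF, hdS], h3, ?_⟩
  rintro ⟨t, ht3, ht⟩
  have hm : ∀ e, e ∈ ({s(a, b), s(b, c), d} : Finset (Sym2 W)) ↔ e ∈ edgesIn t := by
    simp [ht]
  have hab' := mk_mem_edgesIn.1 ((hm s(a, b)).1 (by simp))
  have hbc' := mk_mem_edgesIn.1 ((hm s(b, c)).1 (by simp))
  have hac' := (hm s(a, c)).2 (mk_mem_edgesIn.2 ⟨hab'.1, hbc'.2.1, hac⟩)
  simp only [mem_insert, mem_singleton] at hac'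
  rcases hac' with h | h | h
  · simp at h; grind
  · simp at h; grind
  · exact hdF.2.2 h.symm

/-- The factors carried by at most three edges are uncorrelated unless the edges form a triangle. -/
lemma expect_prod_meet {W : Type} [Fintype W] [DecidableEq W] {N q : ℕ} (h : q ≤ N)
    (φ : ℕ → ℝ) (n : ℕ) {S : Finset (Sym2 W)} (hn : #S = n) (hd : ∀ e ∈ S, ¬ e.IsDiag)
    (hcard : n ≤ 3) (ht : ¬ IsTriangle S) :
    𝔼 α : W → IndexSet N q, ∏ e ∈ S, φ (meet α e) = hyperMean q N φ ^ n := by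
  have := indexSet_nonempty h
  induction n generalizing S with
  | zero =>
    rw [card_eq_zero] at hn
    subst hn
    simp
  | succ n ih =>
    obtain ⟨e, he, v, hv, hleaf⟩ := exists_leaf hd (card_pos.1 (by omega)) (by omega) ht
    have hcard' : #(S.erase e) = n := by rw [card_erase_of_mem he, hn]; rfl
    have ht' : ¬ IsTriangle (S.erase e) := by
      intro hT
      obtain ⟨a, b, c, hab, hac, hbc, hS⟩ := isTriangle_iff.1 hT
      have h3 : #(S.erase e) = 3 := by
        rw [hS]
        refine card_eq_three.2 ⟨_, _, _, ?_, ?_, ?_, rfl⟩ <;> simp <;> grind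
      omega
    rw [pow_succ', ← ih hcard' (fun e' he' => hd e' (mem_of_mem_erase he')) (by omega) ht',
      ← expect_mul_meet_of_leaf h (hd e he) hv]
    · exact expect_congr rfl fun α _ => (prod_erase_mul S _ he).symm
    · intro α β
      refine prod_congr rfl fun e' he' => ?_
      rw [meet_update_of_notMem _ _ (hleaf e' (mem_of_mem_erase he') (ne_of_mem_erase he'))]

end Triangles

/-! ### The parity defect -/

section ParityDefect

open Finset

/-- The difference between `1` and the sign `(-1) ^ k`. -/
noncomputable def parityDefect (k : ℕ) : ℝ := 1 - (-1) ^ k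

lemma parityDefect_eq (k : ℕ) : parityDefect k = if Even k then 0 else 2 := by
  unfold parityDefect
  split_ifs with h
  · rw [h.neg_one_pow]; ring
  · rw [(Nat.not_even_iff_odd.1 h).neg_one_pow]; ring

lemma parityDefect_nonneg (k : ℕ) : 0 ≤ parityDefect k := by
  rw [parityDefect_eq]; split_ifs <;> norm_num

lemma parityDefect_le_two (k : ℕ) : parityDefect k ≤ 2 := by
  rw [parityDefect_eq]; split_ifs <;> norm_num

lemma parityDefect_le_two_mul (k : ℕ) : parityDefect k ≤ 2 * k := by
  rcases Nat.eq_zero_or_pos k with rfl | h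
  · simp [parityDefect]
  · have : (1 : ℝ) ≤ k := by exact_mod_cast h
    linarith [parityDefect_le_two k]

lemma sq_sub_self_nonneg (k : ℕ) : 0 ≤ (k : ℝ) ^ 2 - k := by
  have : (k : ℝ) ≤ k ^ 2 := by exact_mod_cast Nat.le_self_pow two_ne_zero k
  linarith

/-- The defect is `2 k` up to a quantity of the order of the number of pairs among `k` points. -/
lemma two_mul_sub_parityDefect_le (k : ℕ) : 2 * k - parityDefect k ≤ 2 * ((k : ℝ) ^ 2 - k) := by
  rcases k with _ | _ | k
  · simp [parityDefect]
  · simp [parityDefect]; norm_num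
  · have h := parityDefect_nonneg (k + 1 + 1)
    push_cast at *
    nlinarith [(k.cast_nonneg : (0 : ℝ) ≤ k)]

/-- The mean of the defect `1 - (-1) ^ k` for a hypergeometric `k`. -/
noncomputable def meanDefect (q N : ℕ) : ℝ := hyperMean q N parityDefect

lemma meanDefect_nonneg {q N : ℕ} (h : q ≤ N) : 0 ≤ meanDefect q N := by
  rw [← hyperMean_const h 0]
  exact hyperMean_mono q N parityDefect_nonneg

lemma meanDefect_le_two {q N : ℕ} (h : q ≤ N) : meanDefect q N ≤ 2 := by
  rw [← hyperMean_const h 2]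
  exact hyperMean_mono q N parityDefect_le_two

lemma meanDefect_le {q N : ℕ} (h : q ≤ N) : meanDefect q N ≤ 2 * (q ^ 2 / N) := by
  rw [← hyperMean_natCast h, ← hyperMean_const_mul]
  exact hyperMean_mono q N parityDefect_le_two_mul

lemma eta_eq {q N : ℕ} (h : q ≤ N) : eta q N = (-1) ^ q * (1 - meanDefect q N) := by
  have hx : 1 - meanDefect q N = hyperMean q N fun k => 1 - parityDefect k := by
    rw [hyperMean_sub, hyperMean_const h, meanDefect]
  rw [hx, hyperMean, eta, mul_left_comm]
  congr 1
  rw [mul_sum]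
  refine sum_congr rfl fun k _ => ?_
  rw [parityDefect, sub_sub_cancel, pow_add]
  ring

lemma etaG_eq {W : Type} [Fintype W] [DecidableEq W] (G : SimpleGraph W) [DecidableRel G.Adj]
    (q N : ℕ) :
    etaG G q N = (-1) ^ (numEdges G * q) *
      𝔼 α : W → IndexSet N q, ∏ e ∈ G.edgeFinset, (1 - parityDefect (meet α e)) := by
  rw [etaG, Fintype.expect_eq_sum_div_card, Fintype.card_fun, card_indexSet, mul_assoc,
    div_eq_inv_mul, Nat.cast_pow]
  congr 2
  refine sum_congr rfl fun α _ => ?_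
  simp only [parityDefect, sub_sub_cancel]
  rw [prod_pow_eq_pow_sum]
  rfl

end ParityDefect

/-! ### The contribution of a triangle -/

section TriangleMean

open Finset Function

lemma expect_meet {W : Type} [Fintype W] [DecidableEq W] {N q : ℕ} (h : q ≤ N)
    {a b : W} (hab : a ≠ b) (φ : ℕ → ℝ) :
    𝔼 α : W → IndexSet N q, φ (meet α s(a, b)) = hyperMean q N φ := by
  have := indexSet_nonempty h
  have hleaf := expect_mul_meet_of_leaf (N := N) h (e := s(a, b)) hab (Sym2.mem_mk_left a b)
    (fun _ => 1) (fun _ _ => rfl) φ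
  simpa using hleaf

/-- The factors carried by two edges of a path are uncorrelated. -/
lemma expect_meet_mul_meet {W : Type} [Fintype W] [DecidableEq W] {N q : ℕ} (h : q ≤ N)
    {a b c : W} (hab : a ≠ b) (hac : a ≠ c) (hbc : b ≠ c) (φ ψ : ℕ → ℝ) :
    𝔼 α : W → IndexSet N q, φ (meet α s(a, b)) * ψ (meet α s(b, c)) =
      hyperMean q N φ * hyperMean q N ψ := by
  rw [expect_mul_meet_of_leaf h (e := s(b, c)) hbc (Sym2.mem_mk_right b c)
    (fun α => φ (meet α s(a, b))) (fun α β => ?_) ψ, expect_meet h hab, mul_comm]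
  rw [meet_update_of_notMem]
  simp [hac.symm, hbc.symm]

/-- The third moment of the intersection sizes around a triangle, found by resampling one vertex. -/
lemma expect_triangle_natCast {W : Type} [Fintype W] [DecidableEq W] {N q : ℕ} (h : q ≤ N)
    {a b c : W} (hab : a ≠ b) (hac : a ≠ c) (hbc : b ≠ c) :
    𝔼 α : W → IndexSet N q,
      (meet α s(a, b) : ℝ) * (meet α s(b, c) : ℝ) * (meet α s(a, c) : ℝ) =
    hyperMean q N (fun k => (k : ℝ) ^ 2) * ((q : ℝ) / N - q * (q - 1) / (N * (N - 1))) +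
      hyperMean q N (fun k => (k : ℝ)) * (q ^ 2 * (q * (q - 1) / (N * (N - 1)))) := by
  have := indexSet_nonempty h
  rw [← expect_meet (W := W) h hab, ← expect_meet (W := W) h hab, expect_mul, expect_mul,
    ← expect_add_distrib, ← expect_update c]
  refine expect_congr rfl fun α _ => ?_
  simp only [meet_mk, update_self, update_of_ne hac, update_of_ne hbc, mul_assoc]
  rw [← mul_expect, expect_card_inter_mul_card_inter h, inter_comm (α b).1, (α a).2, (α b).2]
  ring

/-- The product of three defects is eight times the product of their arguments, up to terms that
two of the three control. -/
lemma parityDefect_mul_bounds {q k l m : ℕ} (hk : k ≤ q) (hl : l ≤ q) (hm : m ≤ q) :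
    0 ≤ 8 * ((k : ℝ) * l * m) - parityDefect k * parityDefect l * parityDefect m ∧
    8 * ((k : ℝ) * l * m) - parityDefect k * parityDefect l * parityDefect m ≤
      8 * q * (((k : ℝ) ^ 2 - k) * l + k * ((l : ℝ) ^ 2 - l) + ((m : ℝ) ^ 2 - m) * l) := by
  have hk' : (k : ℝ) ≤ q := by exact_mod_cast hk
  have hl' : (l : ℝ) ≤ q := by exact_mod_cast hl
  have hm' : (m : ℝ) ≤ q := by exact_mod_cast hm
  have k0 : (0 : ℝ) ≤ k := k.cast_nonneg
  have l0 : (0 : ℝ) ≤ l := l.cast_nonneg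
  have m0 : (0 : ℝ) ≤ m := m.cast_nonneg
  have ak := parityDefect_nonneg k
  have al := parityDefect_nonneg l
  have am := parityDefect_nonneg m
  have bk := parityDefect_le_two_mul k
  have bl := parityDefect_le_two_mul l
  have bm := parityDefect_le_two_mul m
  have ck := two_mul_sub_parityDefect_le k
  have cl := two_mul_sub_parityDefect_le l
  have cm := two_mul_sub_parityDefect_le m
  have sk := sq_sub_self_nonneg k
  have sl := sq_sub_self_nonneg l
  have sm := sq_sub_self_nonneg m
  have e : 8 * ((k : ℝ) * l * m) - parityDefect k * parityDefect l * parityDefect m =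
      (2 * k - parityDefect k) * (2 * l) * (2 * m) +
      parityDefect k * (2 * l - parityDefect l) * (2 * m) +
      parityDefect k * parityDefect l * (2 * m - parityDefect m) := by ring
  rw [e]
  have dk : 0 ≤ 2 * k - parityDefect k := by linarith
  have dl : 0 ≤ 2 * l - parityDefect l := by linarith
  have dm : 0 ≤ 2 * m - parityDefect m := by linarith
  refine ⟨by positivity, ?_⟩
  have t1 : (2 * k - parityDefect k) * (2 * l) * (2 * m) ≤
      2 * ((k : ℝ) ^ 2 - k) * (2 * l) * (2 * q) := by
    gcongr
  have t2 : parityDefect k * (2 * l - parityDefect l) * (2 * m) ≤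
      2 * k * (2 * ((l : ℝ) ^ 2 - l)) * (2 * q) := by
    gcongr
  have t3 : parityDefect k * parityDefect l * (2 * m - parityDefect m) ≤
      2 * q * (2 * l) * (2 * ((m : ℝ) ^ 2 - m)) := by
    gcongr
    linarith
  linarith

/-- The elementary estimate behind `expect_triangle_bound`, with `u = 1 / N`, with `p` for the
probability of containing two given points, and with `X` and `Y` for the means of the product around
a triangle of the defects and of the intersection sizes. -/
lemma triangle_estimate {q u p m X Y : ℝ} (hq : 0 ≤ q) (hqq : 0 ≤ q * (q - 1)) (hu0 : 0 ≤ u)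
    (hu1 : u ≤ 1) (hp0 : 0 ≤ p) (hp1 : p ≤ q ^ 2 * u ^ 2) (hm0 : 0 ≤ m) (hm1 : m ≤ 2 * (q ^ 2 * u))
    (hY : Y = (q ^ 2 * u + q * (q - 1) * p) * (q * u - p) + q ^ 2 * u * (q ^ 2 * p))
    (hXY0 : 0 ≤ 8 * Y - X) (hXY1 : 8 * Y - X ≤ 8 * q * (3 * (q * (q - 1) * p * (q ^ 2 * u)))) :
    |m ^ 3 - X + 8 * q ^ 3 * u ^ 2| ≤
      (8 * q ^ 6 + 24 * q ^ 7 + 8 * (q ^ 5 + q ^ 4 + 2 * q ^ 6)) * u ^ 3 := by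
  have hr0 : 0 ≤ q * (q - 1) * p := by positivity
  have hr1 : q * (q - 1) * p ≤ q ^ 4 * u ^ 2 := by
    calc q * (q - 1) * p ≤ q ^ 2 * p := by gcongr; nlinarith
      _ ≤ q ^ 2 * (q ^ 2 * u ^ 2) := by gcongr
      _ = _ := by ring
  set r := q * (q - 1) * p
  have hr2 : r ≤ q ^ 4 * u := by
    refine hr1.trans ?_
    gcongr
    nlinarith
  have e : m ^ 3 - X + 8 * q ^ 3 * u ^ 2 =
      m ^ 3 + (8 * Y - X) + 8 * (p * (q ^ 2 * u + r)) - 8 * (q * u * r + q ^ 4 * u * p) := by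
    rw [hY]; ring
  have b1 : m ^ 3 ≤ 8 * q ^ 6 * u ^ 3 := by
    calc m ^ 3 ≤ (2 * (q ^ 2 * u)) ^ 3 := by gcongr
      _ = _ := by ring
  have b2 : 8 * Y - X ≤ 24 * q ^ 7 * u ^ 3 := by
    calc 8 * Y - X ≤ 8 * q * (3 * (r * (q ^ 2 * u))) := hXY1
      _ ≤ 8 * q * (3 * (q ^ 4 * u ^ 2 * (q ^ 2 * u))) := by gcongr
      _ = _ := by ring
  have b3 : p * (q ^ 2 * u + r) ≤ (q ^ 4 + q ^ 6) * u ^ 3 := by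
    calc p * (q ^ 2 * u + r) ≤ q ^ 2 * u ^ 2 * (q ^ 2 * u + q ^ 4 * u) := by gcongr
      _ = _ := by ring
  have b4 : q * u * r + q ^ 4 * u * p ≤ (q ^ 5 + q ^ 6) * u ^ 3 := by
    calc q * u * r + q ^ 4 * u * p ≤ q * u * (q ^ 4 * u ^ 2) + q ^ 4 * u * (q ^ 2 * u ^ 2) := by
          gcongr
      _ = _ := by ring
  have c1 : 0 ≤ m ^ 3 := by positivity
  have c3 : 0 ≤ p * (q ^ 2 * u + r) := by positivity
  have c4 : 0 ≤ q * u * r + q ^ 4 * u * p := by positivity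
  have d1 : 0 ≤ q ^ 4 * u ^ 3 := by positivity
  have d2 : 0 ≤ q ^ 5 * u ^ 3 := by positivity
  have d3 : 0 ≤ q ^ 6 * u ^ 3 := by positivity
  have d4 : 0 ≤ q ^ 7 * u ^ 3 := by positivity
  rw [e, abs_le]
  constructor <;> linarith

/-- The centred defects around a triangle have mean `-8 q³ / N²` to leading order. -/
lemma expect_triangle_bound (q : ℕ) : ∃ C : ℝ, ∀ N : ℕ, q ≤ N → 0 < N →
    ∀ {W : Type} [Fintype W] [DecidableEq W] {S : Finset (Sym2 W)}, IsTriangle S →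
      |𝔼 α : W → IndexSet N q, ∏ e ∈ S, (meanDefect q N - parityDefect (meet α e)) +
        8 * q ^ 3 / N ^ 2| ≤ C / N ^ 3 := by
  refine ⟨8 * q ^ 6 + 24 * q ^ 7 + 8 * (q ^ 5 + q ^ 4 + 2 * q ^ 6), ?_⟩
  intro N hqN hN W _ _ S hS
  have := indexSet_nonempty hqN
  obtain ⟨a, b, c, hab, hac, hbc, rfl⟩ := isTriangle_iff.1 hS
  have h1 : s(a, b) ∉ ({s(b, c), s(a, c)} : Finset (Sym2 W)) := by
    simp; grind
  have h2 : s(b, c) ∉ ({s(a, c)} : Finset (Sym2 W)) := by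
    simp; grind
  set m := meanDefect q N with hm
  have hexp : 𝔼 α : W → IndexSet N q, ∏ e ∈ {s(a, b), s(b, c), s(a, c)},
      (m - parityDefect (meet α e)) = m ^ 3 - 𝔼 α : W → IndexSet N q,
        parityDefect (meet α s(a, b)) * parityDefect (meet α s(b, c)) *
          parityDefect (meet α s(a, c)) := by
    have e : ∀ α : W → IndexSet N q, ∏ e ∈ {s(a, b), s(b, c), s(a, c)},
        (m - parityDefect (meet α e)) =
        m ^ 3 - m ^ 2 * parityDefect (meet α s(a, b)) - m ^ 2 * parityDefect (meet α s(b, c)) -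
          m ^ 2 * parityDefect (meet α s(a, c)) +
          m * (parityDefect (meet α s(a, b)) * parityDefect (meet α s(b, c))) +
          m * (parityDefect (meet α s(a, c)) * parityDefect (meet α s(c, b))) +
          m * (parityDefect (meet α s(b, a)) * parityDefect (meet α s(a, c))) -
          parityDefect (meet α s(a, b)) * parityDefect (meet α s(b, c)) *
            parityDefect (meet α s(a, c)) := by
      intro α
      rw [prod_insert h1, prod_insert h2, prod_singleton, Sym2.eq_swap (a := c),
        Sym2.eq_swap (a := b) (b := a)]
      ring
    simp only [e, expect_sub_distrib, expect_add_distrib, ← mul_expect]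
    rw [Fintype.expect_const, expect_meet hqN hab, expect_meet hqN hbc, expect_meet hqN hac,
      expect_meet_mul_meet hqN hab hac hbc, expect_meet_mul_meet hqN hac hab hbc.symm,
      expect_meet_mul_meet hqN hab.symm hbc hac, ← meanDefect, ← hm]
    ring
  set X := 𝔼 α : W → IndexSet N q, parityDefect (meet α s(a, b)) *
    parityDefect (meet α s(b, c)) * parityDefect (meet α s(a, c)) with hX
  set p := (q : ℝ) * (q - 1) / (N * (N - 1)) with hp
  obtain ⟨hp0, hp1⟩ := pair_prob_bounds hqN
  rw [← hp] at hp0 hp1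
  have hkkk := expect_triangle_natCast (W := W) hqN hab hac hbc
  set Y := 𝔼 α : W → IndexSet N q,
    (meet α s(a, b) : ℝ) * (meet α s(b, c) : ℝ) * (meet α s(a, c) : ℝ) with hY
  have hμ1 := hyperMean_natCast hqN
  have hμ2 := hyperMean_sq hqN
  have hμ3 : hyperMean q N (fun k => (k : ℝ) ^ 2 - k) = q * (q - 1) * p := by
    rw [hyperMean_sub, hμ1, hμ2]; ring
  have hXY0 : 0 ≤ 8 * Y - X := by
    rw [hY, hX, mul_expect, ← expect_sub_distrib]
    exact expect_nonneg fun α _ =>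
      (parityDefect_mul_bounds (meet_le α _) (meet_le α _) (meet_le α _)).1
  have hXY1 : 8 * Y - X ≤ 8 * q * (3 * (q * (q - 1) * p * (q ^ 2 / N))) := by
    have e : 8 * q * (3 * (q * (q - 1) * p * (q ^ 2 / N))) = 𝔼 α : W → IndexSet N q,
        8 * (q : ℝ) * (((meet α s(a, b) : ℝ) ^ 2 - meet α s(a, b)) * meet α s(b, c) +
          meet α s(a, b) * ((meet α s(b, c) : ℝ) ^ 2 - meet α s(b, c)) +
          ((meet α s(a, c) : ℝ) ^ 2 - meet α s(a, c)) * meet α s(c, b)) := by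
      rw [← mul_expect, expect_add_distrib, expect_add_distrib,
        expect_meet_mul_meet hqN hab hac hbc (fun k => (k : ℝ) ^ 2 - k) (fun k => (k : ℝ)),
        expect_meet_mul_meet hqN hab hac hbc (fun k => (k : ℝ)) (fun k => (k : ℝ) ^ 2 - k),
        expect_meet_mul_meet hqN hac hab hbc.symm (fun k => (k : ℝ) ^ 2 - k) (fun k => (k : ℝ)),
        hμ1, hμ3]
      ring
    rw [e, hY, hX, mul_expect, ← expect_sub_distrib]
    refine expect_le_expect fun α _ => ?_
    rw [Sym2.eq_swap (a := c)]
    exact (parityDefect_mul_bounds (meet_le α _) (meet_le α _) (meet_le α _)).2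
  rw [hexp]
  have hm0 : 0 ≤ m := meanDefect_nonneg hqN
  have hm1 : m ≤ 2 * (q ^ 2 / N) := meanDefect_le hqN
  have hNR : (1 : ℝ) ≤ N := by exact_mod_cast hN
  -- from here on only real numbers matter: put `u = 1 / N`
  obtain ⟨u, hu⟩ : ∃ u : ℝ, u = 1 / N := ⟨_, rfl⟩
  have hu0 : 0 ≤ u := by rw [hu]; positivity
  have hu1 : u ≤ 1 := by rw [hu, div_le_one (by positivity)]; exact hNR
  have hdiv : ∀ x : ℝ, x / N = x * u := fun x => by rw [hu]; ring
  have hdiv2 : ∀ x : ℝ, x / (N : ℝ) ^ 2 = x * u ^ 2 := fun x => by rw [hu]; ring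
  have hdiv3 : ∀ x : ℝ, x / (N : ℝ) ^ 3 = x * u ^ 3 := fun x => by rw [hu]; ring
  rw [hμ1, hμ2, ← hp] at hkkk
  simp only [hdiv, hdiv2, hdiv3] at *
  have hq0 : 0 ≤ (q : ℝ) * (q - 1) := by
    rcases q with _ | q
    · simp
    · push_cast; rw [add_sub_cancel_right]; positivity
  exact triangle_estimate q.cast_nonneg hq0 hu0 hu1 hp0 hp1 hm0 hm1 hkkk hXY0 hXY1

end TriangleMean

/-! ### The expansion -/

section Expansion

open Finset

/-- The contribution of a single set `S` of edges to the expansion of `η_G`: to order `1 / N²`, only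
the empty set and the triangles contribute. -/
lemma abs_contribution_le {W : Type} [Fintype W] [DecidableEq W] (q n : ℕ) {S : Finset (Sym2 W)}
    [Decidable (IsTriangle S)] (hd : ∀ e ∈ S, ¬ e.IsDiag) :
    ∃ C : ℝ, ∀ N : ℕ, q ≤ N → 0 < N →
      |(1 - meanDefect q N) ^ n *
          𝔼 α : W → IndexSet N q, ∏ e ∈ S, (meanDefect q N - parityDefect (meet α e)) -
        ((if S = ∅ then (1 - meanDefect q N) ^ n else 0) +
          if IsTriangle S then -(8 * (q : ℝ) ^ 3 / N ^ 2) else 0)| ≤ C / N ^ 3 := by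
  have hx : ∀ {N : ℕ}, q ≤ N → |1 - meanDefect q N| ≤ 1 := fun h =>
    abs_le.2 ⟨by linarith [meanDefect_le_two h], by linarith [meanDefect_nonneg h]⟩
  by_cases ht : IsTriangle S
  · have hne : S ≠ ∅ := by
      rintro rfl
      obtain ⟨a, b, c, -, -, -, h⟩ := isTriangle_iff.1 ht
      simpa using congrArg (s(a, b) ∈ ·) h
    obtain ⟨C, hC⟩ := expect_triangle_bound q
    refine ⟨C + n * (2 * q ^ 2) * (8 * q ^ 3), fun N hqN hN => ?_⟩
    have hN' : (0 : ℝ) < N := by exact_mod_cast hN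
    have h1 := hC N hqN hN ht
    have hx1 := hx hqN
    have hb : 1 + (n : ℝ) * (-meanDefect q N) ≤ (1 + -meanDefect q N) ^ n :=
      one_add_mul_le_pow (by linarith [meanDefect_le_two hqN]) n
    have hm1 := meanDefect_le hqN
    have hpow : |(1 - meanDefect q N) ^ n| ≤ 1 := by
      rw [abs_pow]; exact pow_le_one₀ (abs_nonneg _) hx1
    rw [if_neg hne, if_pos ht, zero_add]
    set τ := 𝔼 α : W → IndexSet N q, ∏ e ∈ S, (meanDefect q N - parityDefect (meet α e))
    set x := (1 - meanDefect q N) ^ n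
    set L := 8 * (q : ℝ) ^ 3 / N ^ 2 with hL
    have hL0 : 0 ≤ L := by positivity
    have hx1' : |1 - x| ≤ n * (2 * (q ^ 2 / N)) := by
      rw [abs_of_nonneg (by linarith [le_abs_self x])]
      have : (n : ℝ) * meanDefect q N ≤ n * (2 * (q ^ 2 / N)) := by gcongr
      have hxe : x = (1 + -meanDefect q N) ^ n := by rw [← sub_eq_add_neg]
      linarith
    have e : x * τ - -L = x * (τ + L) + (1 - x) * L := by ring
    calc |x * τ - -L| ≤ |x * (τ + L)| + |(1 - x) * L| := by rw [e]; exact abs_add_le _ _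
      _ = |x| * |τ + L| + |1 - x| * L := by rw [abs_mul, abs_mul, abs_of_nonneg hL0]
      _ ≤ 1 * (C / N ^ 3) + n * (2 * (q ^ 2 / N)) * L := by gcongr
      _ = (C + n * (2 * q ^ 2) * (8 * q ^ 3)) / N ^ 3 := by rw [hL]; field_simp
  by_cases hcard : #S ≤ 3
  · refine ⟨0, fun N hqN _ => ?_⟩
    rw [expect_prod_meet hqN (fun k => meanDefect q N - parityDefect k) #S rfl hd hcard ht,
      hyperMean_sub, hyperMean_const hqN, ← meanDefect, sub_self, if_neg ht]
    rcases S.eq_empty_or_nonempty with rfl | hne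
    · simp
    · simp [hne.ne_empty, hne.card_pos.ne']
  · obtain ⟨F, hFS, hF3, hFt⟩ := exists_subset_not_isTriangle (by omega : 4 ≤ #S)
    have hne : S ≠ ∅ := by rintro rfl; simp at hcard
    refine ⟨2 ^ #(S \ F) * (4 * q ^ 2) ^ 3, fun N hqN hN => ?_⟩
    have hN' : (0 : ℝ) < N := by exact_mod_cast hN
    rw [if_neg hne, if_neg ht, add_zero, sub_zero, abs_mul, abs_pow]
    set m := meanDefect q N with hm
    have hm0 : 0 ≤ m := meanDefect_nonneg hqN
    have hm2 : m ≤ 2 := meanDefect_le_two hqN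
    have hg : ∀ k, |m - parityDefect k| ≤ 2 := fun k =>
      abs_le.2 ⟨by linarith [parityDefect_le_two k], by linarith [parityDefect_nonneg k]⟩
    have hmean : hyperMean q N (fun k => |m - parityDefect k|) ≤ 4 * q ^ 2 / N := by
      calc hyperMean q N (fun k => |m - parityDefect k|)
          ≤ hyperMean q N (fun k => m + parityDefect k) :=
            hyperMean_mono q N fun k => abs_le.2
              ⟨by linarith [parityDefect_nonneg k], by linarith [parityDefect_nonneg k]⟩
        _ = m + m := by rw [hyperMean_add, hyperMean_const hqN, ← meanDefect]
        _ ≤ 2 * (q ^ 2 / N) + 2 * (q ^ 2 / N) := add_le_add (meanDefect_le hqN) (meanDefect_le hqN)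
        _ = _ := by ring
    have hmean0 : 0 ≤ hyperMean q N (fun k => |m - parityDefect k|) := by
      rw [← hyperMean_const hqN 0]
      exact hyperMean_mono q N fun k => abs_nonneg _
    have hE : |𝔼 α : W → IndexSet N q, ∏ e ∈ S, (m - parityDefect (meet α e))| ≤
        2 ^ #(S \ F) * (4 * q ^ 2 / N) ^ 3 := by
      calc |𝔼 α : W → IndexSet N q, ∏ e ∈ S, (m - parityDefect (meet α e))|
          ≤ 𝔼 α : W → IndexSet N q, |∏ e ∈ S, (m - parityDefect (meet α e))| := abs_expect_le _ _
        _ ≤ 𝔼 α : W → IndexSet N q,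
            2 ^ #(S \ F) * ∏ e ∈ F, |m - parityDefect (meet α e)| := by
          refine expect_le_expect fun α _ => ?_
          rw [abs_prod, ← prod_sdiff hFS]
          gcongr
          exact (prod_le_prod (fun _ _ => abs_nonneg _) fun e _ => hg _).trans_eq (prod_const 2)
        _ = 2 ^ #(S \ F) * hyperMean q N (fun k => |m - parityDefect k|) ^ 3 := by
          rw [← mul_expect, expect_prod_meet hqN (fun k => |m - parityDefect k|) 3 hF3
            (fun e he => hd e (hFS he)) le_rfl hFt]
        _ ≤ _ := by gcongr
    calc |1 - m| ^ n * |𝔼 α : W → IndexSet N q, ∏ e ∈ S, (m - parityDefect (meet α e))|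
        ≤ 1 * (2 ^ #(S \ F) * (4 * q ^ 2 / N) ^ 3) := by
          gcongr
          exact pow_le_one₀ (abs_nonneg _) (hx hqN)
      _ = _ := by field_simp

/-- The expansion of `η_G` for an arbitrary graph. -/
theorem etaG_sub_eta_pow_isBigO {W : Type} [Fintype W] [DecidableEq W] (G : SimpleGraph W)
    [DecidableRel G.Adj] (q : ℕ) :
    (fun N : ℕ => (etaG G q N - eta q N ^ numEdges G) -
        (-(8 * (q : ℝ) ^ 3 / (N : ℝ) ^ 2) * (-1) ^ (q * numEdges G) * (numTriangles G : ℝ)))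
      =O[atTop] fun N : ℕ => 1 / (N : ℝ) ^ 3 := by
  classical
  have hd : ∀ S ∈ G.edgeFinset.powerset, ∀ e ∈ S, ¬ e.IsDiag := fun S hS e he =>
    G.not_isDiag_of_mem_edgeFinset (mem_powerset.1 hS he)
  have hex : ∀ S : Finset (Sym2 W), ∃ C : ℝ, S ∈ G.edgeFinset.powerset →
      ∀ N : ℕ, q ≤ N → 0 < N →
      |(1 - meanDefect q N) ^ #(G.edgeFinset \ S) *
          𝔼 α : W → IndexSet N q, ∏ e ∈ S, (meanDefect q N - parityDefect (meet α e)) -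
        ((if S = ∅ then (1 - meanDefect q N) ^ #(G.edgeFinset \ S) else 0) +
          if IsTriangle S then -(8 * (q : ℝ) ^ 3 / N ^ 2) else 0)| ≤ C / N ^ 3 := by
    intro S
    by_cases hS : S ∈ G.edgeFinset.powerset
    · obtain ⟨C, hC⟩ := abs_contribution_le q #(G.edgeFinset \ S) (hd S hS)
      exact ⟨C, fun _ => hC⟩
    · exact ⟨0, fun h => absurd h hS⟩
  choose C hC using hex
  refine IsBigO.of_bound (∑ S ∈ G.edgeFinset.powerset, C S) ?_
  filter_upwards [eventually_ge_atTop q, eventually_gt_atTop 0] with N hqN hN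
  have hexpand : 𝔼 α : W → IndexSet N q, ∏ e ∈ G.edgeFinset, (1 - parityDefect (meet α e)) =
      ∑ S ∈ G.edgeFinset.powerset, (1 - meanDefect q N) ^ #(G.edgeFinset \ S) *
        𝔼 α : W → IndexSet N q, ∏ e ∈ S, (meanDefect q N - parityDefect (meet α e)) := by
    simp only [mul_expect]
    rw [← expect_sum_comm]
    refine expect_congr rfl fun α _ => ?_
    rw [prod_congr rfl (g := fun e => (meanDefect q N - parityDefect (meet α e)) +
      (1 - meanDefect q N)) (fun e _ => by ring), prod_add]
    exact sum_congr rfl fun S _ => by rw [prod_const, mul_comm]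
  have hmain : ∑ S ∈ G.edgeFinset.powerset,
      ((if S = ∅ then (1 - meanDefect q N) ^ #(G.edgeFinset \ S) else 0) +
        if IsTriangle S then -(8 * (q : ℝ) ^ 3 / N ^ 2) else 0) =
      (1 - meanDefect q N) ^ numEdges G + -(8 * (q : ℝ) ^ 3 / N ^ 2) * numTriangles G := by
    rw [sum_add_distrib, sum_ite_eq' _ ∅, if_pos (empty_mem_powerset _), sdiff_empty, ← sum_filter,
      sum_const, card_filter_isTriangle, nsmul_eq_mul, numEdges, mul_comm (numTriangles G : ℝ)]
  have e : (etaG G q N - eta q N ^ numEdges G) -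
        (-(8 * (q : ℝ) ^ 3 / (N : ℝ) ^ 2) * (-1) ^ (q * numEdges G) * (numTriangles G : ℝ)) =
      (-1) ^ (q * numEdges G) * ∑ S ∈ G.edgeFinset.powerset,
        ((1 - meanDefect q N) ^ #(G.edgeFinset \ S) *
          𝔼 α : W → IndexSet N q, ∏ e ∈ S, (meanDefect q N - parityDefect (meet α e)) -
        ((if S = ∅ then (1 - meanDefect q N) ^ #(G.edgeFinset \ S) else 0) +
          if IsTriangle S then -(8 * (q : ℝ) ^ 3 / N ^ 2) else 0)) := by
    rw [sum_sub_distrib, hmain, ← hexpand, etaG_eq, eta_eq hqN, mul_pow, ← pow_mul,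
      mul_comm (numEdges G) q]
    ring
  rw [e, norm_mul, norm_pow, norm_neg, norm_one, one_pow, one_mul, Real.norm_eq_abs,
    Real.norm_of_nonneg (by positivity), sum_mul]
  refine (abs_sum_le_sum_abs _ _).trans (sum_le_sum fun S hS => ?_)
  rw [mul_one_div]
  exact hC S hS N hqN hN

/-- A combination of `1 / N` and `1 / N²` is of order `1 / N³` only if it vanishes. -/
lemma isBigO_inv_cube_iff (a b : ℝ) :
    ((fun N : ℕ => a / (N : ℝ) + b / (N : ℝ) ^ 2) =O[atTop] fun N : ℕ => 1 / (N : ℝ) ^ 3) ↔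
      a = 0 ∧ b = 0 := by
  constructor
  swap
  · rintro ⟨rfl, rfl⟩
    simpa using isBigO_zero _ _
  intro h
  have hinv : Tendsto (fun N : ℕ => ((N : ℝ))⁻¹) atTop (nhds 0) :=
    tendsto_inv_atTop_zero.comp tendsto_natCast_atTop_atTop
  -- multiplied by `N²`, a quantity of order `1 / N³` still tends to zero
  have h2 : Tendsto (fun N : ℕ => a * (N : ℝ) + b) atTop (nhds 0) := by
    have hO : (fun N : ℕ => a * (N : ℝ) + b) =O[atTop] fun N : ℕ => ((N : ℝ))⁻¹ := by
      refine ((isBigO_refl (fun N : ℕ => (N : ℝ) ^ 2) atTop).mul h).congr' ?_ ?_ <;>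
        filter_upwards [eventually_gt_atTop 0] with N hN <;> field_simp
    exact hO.trans_tendsto hinv
  have ha : a = 0 := by
    have h3 := (h2.mul hinv).congr' (f₂ := fun N : ℕ => a + b * (N : ℝ)⁻¹) (by
      filter_upwards [eventually_gt_atTop 0] with N hN
      field_simp)
    have h4 : Tendsto (fun N : ℕ => a + b * (N : ℝ)⁻¹) atTop (nhds (a + b * 0)) :=
      tendsto_const_nhds.add (hinv.const_mul b)
    simpa using tendsto_nhds_unique h4 h3
  subst ha
  exact ⟨rfl, by simpa using h2⟩

end Expansion

theorem mainTheorem1 (q p : ℕ) :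
    -- every intersection graph `G` of a chord diagram with `p` chords
    (∀ D : ChordDiagram p,
      ((fun N : ℕ =>
          (etaG D.intersectionGraph q N - eta q N ^ numEdges D.intersectionGraph) -
            (-(8 * (q : ℝ) ^ 3 / (N : ℝ) ^ 2) * (-1) ^ (q * numEdges D.intersectionGraph) *
              (numTriangles D.intersectionGraph : ℝ)))
        =O[atTop] fun N : ℕ => 1 / (N : ℝ) ^ 3) ∧
      ((fun N : ℕ =>
          etaG D.intersectionGraph q N - eta q N ^ numEdges D.intersectionGraph)
        =O[atTop] fun N : ℕ => 1 / (N : ℝ) ^ 2)) ∧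
    -- the expansion coefficients of the sum over all chord diagrams with `p` chords
    (∀ a₁ a₂ : ℝ,
      ((fun N : ℕ =>
          (∑ D : ChordDiagram p, etaG D.intersectionGraph q N -
            ∑ D : ChordDiagram p, eta q N ^ numEdges D.intersectionGraph) -
            (a₁ / (N : ℝ) + a₂ / (N : ℝ) ^ 2))
        =O[atTop] fun N : ℕ => 1 / (N : ℝ) ^ 3) ↔
      a₁ = 0 ∧
      a₂ = -8 * (q : ℝ) ^ 3 *
        ∑ D : ChordDiagram p, (-1) ^ (q * numEdges D.intersectionGraph) *
          (numTriangles D.intersectionGraph : ℝ)) := by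
  refine ⟨fun D => ⟨etaG_sub_eta_pow_isBigO _ q, ?_⟩, fun a₁ a₂ => ?_⟩
  · have h := etaG_sub_eta_pow_isBigO D.intersectionGraph q
    have h32 : (fun N : ℕ => 1 / (N : ℝ) ^ 3) =O[atTop] fun N : ℕ => 1 / (N : ℝ) ^ 2 := by
      refine IsBigO.of_bound 1 ?_
      filter_upwards [eventually_gt_atTop 0] with N hN
      have hN' : (1 : ℝ) ≤ N := by exact_mod_cast hN
      rw [Real.norm_of_nonneg (by positivity), Real.norm_of_nonneg (by positivity), one_mul]
      gcongr
      norm_num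
    have h2 : (fun N : ℕ => -(8 * (q : ℝ) ^ 3 / (N : ℝ) ^ 2) *
        (-1) ^ (q * numEdges D.intersectionGraph) * (numTriangles D.intersectionGraph : ℝ))
        =O[atTop] fun N : ℕ => 1 / (N : ℝ) ^ 2 :=
      ((isBigO_refl (fun N : ℕ => 1 / (N : ℝ) ^ 2) atTop).const_mul_left
        (-(8 * (q : ℝ) ^ 3) * (-1) ^ (q * numEdges D.intersectionGraph) *
          (numTriangles D.intersectionGraph : ℝ))).congr_left fun N => by ring
    exact ((h.trans h32).add h2).congr_left fun N => sub_add_cancel _ _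
  · set A := -8 * (q : ℝ) ^ 3 * ∑ D : ChordDiagram p,
      (-1) ^ (q * numEdges D.intersectionGraph) * (numTriangles D.intersectionGraph : ℝ) with hA
    -- the sum over all diagrams has the expansion with coefficients `0` and `A`
    have hsum : (fun N : ℕ => (∑ D : ChordDiagram p, etaG D.intersectionGraph q N -
        ∑ D : ChordDiagram p, eta q N ^ numEdges D.intersectionGraph) - A / (N : ℝ) ^ 2)
        =O[atTop] fun N : ℕ => 1 / (N : ℝ) ^ 3 := by
      refine (IsBigO.sum fun (D : ChordDiagram p) (_ : D ∈ Finset.univ) =>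
        etaG_sub_eta_pow_isBigO D.intersectionGraph q).congr_left fun N => ?_
      rw [Finset.sum_apply, Finset.sum_sub_distrib, Finset.sum_sub_distrib, hA,
        Finset.mul_sum, Finset.sum_div]
      congr 1
      exact Finset.sum_congr rfl fun D _ => by ring
    rw [← sub_eq_zero (a := a₂), ← isBigO_inv_cube_iff]
    constructor
    · exact fun h => (hsum.sub h).congr_left fun N => by ring
    · exact fun h => (hsum.sub h).congr_left fun N => by ring
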